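/- Notation. Put $\{x\}=x-x^{-1}$, $D=\{A\}/\{q\}$, $\phi=A\{q\}$ and, for $n\ge 0$, $\widetilde\Phi_n=\big((D+\phi)^n-\phi^n\big)/D$. Tangle diagrams are oriented and are evaluated (in the vertical framing) by the Reshetikhin–Turaev functor of the fundamental representation of $U_q(\mathfrak{sl}_N)$, $N\ge 1$, $q$ an indeterminate, $A=q^N$; the positive crossing acts by the $R$-matrix with eigenvalues $q,-q^{-1}$, and a circle has value $D=[N]$. The (unreduced, fundamental) HOMFLY polynomial $H^L\in\mathbb Q(q)(A)$ of a link diagram $L$ of writhe $w$ is the element which, for every $N\ge1$, is regular at $A=q^N$ and takes there the value $A^{-w}$ times the $\mathfrak{sl}_N$ evaluation of $L$. The vertical antiparallel lock is the tangle diagram with left ends directed downward and right ends directed upward in which the strand from top left to top right dips through a local minimum, the strand from bottom right to bottom left rises through a local maximum, and the two are clasped by two positive crossings placed side by side. The necklace tangle $\mathrm{ON}_n$ is the stack of $n\ge 0$ such locks (for $n=0$, two vertical strands). Write $\|$ for two vertical strands and ${\smallsmile}\atop{\smallfrown}$ for the cup-cap tangle, with the same ends. Theorem. (1) Both in $\mathbb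 Q(q)(A)$ and for $A=q^N$, $N\ge1$ (where $D\ne0$), one has $\widetilde\Phi_n=\frac1D\sum_{k=1}^n\binom nk D^k\phi^{n-k}$ for all $n\ge0$. (2) For all $N\ge1$ and $n\ge0$, with $A=q^N$, the evaluations satisfy $$\mathrm{ON}_n=\widetilde\Phi_n\cdot{{\smallsmile}\atop{\smallfrown}}+\phi^n\cdot\|.$$ (3) Let $\mathrm{Neck}^{\mathrm{cl}}_n$ be obtained from $\mathrm{ON}_n$ by joining its two left ends to each other and its two right ends to each other, and $\mathrm{Neck}^{\mathrm{op}}_{n+1}$ by joining its two top ends to each other and its two bottom ends to each other. For all $N\ge 1$, $n\ge0$, with $A=q^N$, their evaluations in the vertical framing are $\widetilde\Phi_nD+\phi^nD^2$ and $\widetilde\Phi_nD^2+\phi^nD$ respectively. (4) For all $n\ge0$ the HOMFLY polynomials of these links exist, are unique, and are $$H^{\mathrm{Neck}^{\mathrm{cl}}_n}=A^{-2n}\big((D+\phi)^n+\phi^n(D^2-1)\big),\qquad H^{\mathrm{Neck}^{\mathrm{op}}_{n+1}}=A^{-2n}\,D\,(D+\phi)^n .$$ Moreover there are $F^{\mathrm{cl}}_n$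 (for $n\ge1$) and $F^{\mathrm{op}}_{n+1}$ (for $n\ge0$) in $\mathbb Z[q^{\pm1},A^{\pm1}]$ with $$H^{\mathrm{Neck}^{\mathrm{cl}}_n}=D^n\Big(1+\frac{\{Aq\}\{A/q\}}{\{A\}^{n-1}}F^{\mathrm{cl}}_n\Big),\qquad H^{\mathrm{Neck}^{\mathrm{op}}_{n+1}}=D^{n+1}\Big(1+\frac{\{Aq\}\{A/q\}}{\{A\}^{n}}F^{\mathrm{op}}_{n+1}\Big).$$ (5) The Hopf link, drawn as the closure of the two-strand braid with two positive crossings, has the same HOMFLY polynomial as $\mathrm{Neck}^{\mathrm{op}}_2$ (one lock), namely $$H^{\mathrm{Hopf}}=A^{-1}\frac{\{A\}}{\{q\}^2}\big(-A^{-2}+q^2+q^{-2}-1\big)=D^2\Big(1-A^{-1}\frac{\{Aq\}\{A/q\}}{\{A\}}\Big).$$ -/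

import Mathlib

namespace Necklace

/-! ### Oriented tangle diagrams

A diagram is drawn from bottom to top. Its bottom and top boundaries are words in the two
directions of a strand, read from left to right. -/

/-- The direction in which a strand crosses a horizontal line. -/
inductive Dir
  | up
  | down
  deriving DecidableEq

/-- The opposite direction. -/
def Dir.flip : Dir → Dir
  | .up => .down
  | .down => .up

/-- Oriented tangle diagrams in generic position with given bottom and top boundary.
* `cup d` is a local minimum, whose left leg has direction `d`;
* `cap d` is a local maximum, whose left leg has direction `d`;
* `cross d pos` is a crossing of two strands that both have direction `d`; it is the positive
  crossing if `pos` is `true` (for `d = up`: the strand from bottom left to top right goes over) and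
  the negative crossing if `pos` is `false`; the crossings with `d = down` are those with `d = up`
  turned by the angle `π`;
* `comp S T` puts `T` on top of `S`;
* `tensor S T` puts `T` to the right of `S`. -/
inductive Tangle : List Dir → List Dir → Type
  | id (s : List Dir) : Tangle s s
  | cup (d : Dir) : Tangle [] [d, d.flip]
  | cap (d : Dir) : Tangle [d, d.flip] []
  | cross (d : Dir) (pos : Bool) : Tangle [d, d] [d, d]
  | comp {s t u : List Dir} : Tangle s t → Tangle t u → Tangle s u
  | tensor {s t s' t' : List Dir} : Tangle s t → Tangle s' t' → Tangle (s ++ s') (t ++ t')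

/-- Diagrams of oriented links. -/
abbrev LinkDiagram : Type := Tangle [] []

/-- The writhe: the number of positive crossings minus the number of negative crossings. -/
def Tangle.writhe : {s t : List Dir} → Tangle s t → ℤ
  | _, _, .id _ => 0
  | _, _, .cup _ => 0
  | _, _, .cap _ => 0
  | _, _, .cross _ pos => if pos then 1 else -1
  | _, _, .comp S T => S.writhe + T.writhe
  | _, _, .tensor S T => S.writhe + T.writhe

/-! ### The fundamental `sl_N` evaluation of a tangle diagram (vertical framing) -/

/-- Basis vectors of the tensor product of copies of the fundamental representation (`up`) and of
its dual (`down`) belonging to a word: one index in `Fin N` for each letter. -/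
def Coloring (N : ℕ) : List Dir → Type
  | [] => Unit
  | _ :: s => Fin N × Coloring N s

instance Coloring.instFintype (N : ℕ) : (s : List Dir) → Fintype (Coloring N s)
  | [] => inferInstanceAs (Fintype Unit)
  | _ :: s =>
    letI := Coloring.instFintype N s
    inferInstanceAs (Fintype (Fin N × Coloring N s))

instance Coloring.instDecidableEq (N : ℕ) : (s : List Dir) → DecidableEq (Coloring N s)
  | [] => inferInstanceAs (DecidableEq Unit)
  | _ :: s =>
    letI := Coloring.instDecidableEq N s
    inferInstanceAs (DecidableEq (Fin N × Coloring N s))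

/-- The part of a colouring of `s ++ t` on `s`. -/
def Coloring.left {N : ℕ} : (s : List Dir) → {t : List Dir} → Coloring N (s ++ t) → Coloring N s
  | [], _, _ => ()
  | _ :: s, _, x => (x.1, Coloring.left s x.2)

/-- The part of a colouring of `s ++ t` on `t`. -/
def Coloring.right {N : ℕ} : (s : List Dir) → {t : List Dir} → Coloring N (s ++ t) → Coloring N t
  | [], _, x => x
  | _ :: s, _, x => Coloring.right s x.2

section Evaluation

variable {K : Type*} [Field K]

/-- The bracket `{x} = x - x⁻¹`. -/
def br (x : K) : K := x - x⁻¹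

/-- The fundamental `R`-matrix of `U_q(sl_N)`, in the normalization with eigenvalues `q` and
`-q⁻¹`: the coefficient of `e_k ⊗ e_l` in `R (e_i ⊗ e_j)`. -/
def rMatrix (q : K) {N : ℕ} (i j k l : Fin N) : K :=
  if i = j then (if k = i ∧ l = i then q else 0)
  else if k = j ∧ l = i then 1
  else if k = i ∧ l = j ∧ i < j then br q
  else 0

/-- The inverse of the `R`-matrix. -/
def rMatrixInv (q : K) {N : ℕ} (i j k l : Fin N) : K :=
  if i = j then (if k = i ∧ l = i then q⁻¹ else 0)
  else if k = j ∧ l = i then 1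
  else if k = i ∧ l = j ∧ j < i then -br q
  else 0

/-- The matrix of the positive or of the negative crossing of two upward strands. -/
def crossMatrix (q : K) (pos : Bool) {N : ℕ} (i j k l : Fin N) : K :=
  if pos then rMatrix q i j k l else rMatrixInv q i j k l

/-- The weights of the quantum trace: `q ^ (1 - N), q ^ (3 - N), …, q ^ (N - 1)`. -/
def weight (q : K) {N : ℕ} (i : Fin N) : K := q ^ (2 * (i : ℤ) + 1 - (N : ℤ))

/-- The (Reshetikhin–Turaev) evaluation of a tangle diagram in the fundamental representation of
`sl_N`: the matrix, in the standard bases, of the linear map from the representation of the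
bottom boundary (row index) to that of the top boundary (column index). -/
def Tangle.eval (q : K) (N : ℕ) :
    {s t : List Dir} → Tangle s t → Matrix (Coloring N s) (Coloring N t) K
  | _, _, .id _ => 1
  | _, _, .cup .up => Matrix.of fun _ (y : Fin N × Fin N × Unit) =>
      if y.1 = y.2.1 then 1 else 0
  | _, _, .cup .down => Matrix.of fun _ (y : Fin N × Fin N × Unit) =>
      if y.1 = y.2.1 then (weight q y.1)⁻¹ else 0
  | _, _, .cap .up => Matrix.of fun (x : Fin N × Fin N × Unit) _ =>
      if x.1 = x.2.1 then weight q x.1 else 0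
  | _, _, .cap .down => Matrix.of fun (x : Fin N × Fin N × Unit) _ =>
      if x.1 = x.2.1 then 1 else 0
  | _, _, .cross .up pos => Matrix.of fun (x y : Fin N × Fin N × Unit) =>
      crossMatrix q pos x.1 x.2.1 y.1 y.2.1
  | _, _, .cross .down pos => Matrix.of fun (x y : Fin N × Fin N × Unit) =>
      crossMatrix q pos y.2.1 y.1 x.2.1 x.1
  | _, _, .comp S T => S.eval q N * T.eval q N
  | _, _, .tensor (s := s) (t := t) S T => Matrix.of fun x y =>
      S.eval q N (Coloring.left s x) (Coloring.left t y) *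
        T.eval q N (Coloring.right s x) (Coloring.right t y)

/-- The value of a link diagram. -/
def linkEval (q : K) (N : ℕ) (L : LinkDiagram) : K := L.eval q N () ()

/-! ### The quantities `D`, `φ` and `Φ̃_n` -/

/-- `D = {A} / {q}`. -/
def dim (q A : K) : K := br A / br q

/-- `φ = A {q}`. -/
def phi (q A : K) : K := A * br q

/-- `Φ̃_n = ((D + φ)^n - φ^n) / D`. -/
def phiTilde (q A : K) (n : ℕ) : K :=
  ((dim q A + phi q A) ^ n - phi q A ^ n) / dim q A

end Evaluation

/-! ### The HOMFLY polynomial -/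

/-- The field `ℚ(q)`. -/
abbrev Kq : Type := RatFunc ℚ

/-- The field `ℚ(q)(A)`. -/
abbrev KqA : Type := RatFunc Kq

/-- The variable `q` of `ℚ(q)`. -/
noncomputable def q₀ : Kq := RatFunc.X

/-- The element `q` of `ℚ(q)(A)`. -/
noncomputable def qq : KqA := RatFunc.C q₀

/-- The element `A` of `ℚ(q)(A)`. -/
noncomputable def aa : KqA := RatFunc.X

/-- `H` is the (unreduced, fundamental) HOMFLY polynomial of the link diagram `L`, in the
topological framing: for every `N ≥ 1` it is regular at `A = q ^ N`, where its value is the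
`sl_N` evaluation of `L` times the framing factor `A ^ (-writhe)`. -/
def IsHomfly (L : LinkDiagram) (H : KqA) : Prop :=
  ∀ N : ℕ, 1 ≤ N → H.denom.eval (q₀ ^ N) ≠ 0 ∧
    H.eval (RingHom.id Kq) (q₀ ^ N) = (q₀ ^ N) ^ (-L.writhe) * linkEval q₀ N L

/-- The ring `ℤ[q, q⁻¹, A, A⁻¹]` inside `ℚ(q)(A)`. -/
noncomputable def intLaurent : Subalgebra ℤ KqA :=
  Algebra.adjoin ℤ {qq, qq⁻¹, aa, aa⁻¹}

/-! ### Locks and necklaces -/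

/-- The boundary of the anti-parallel tangles: a downward strand on the left and an upward strand
on the right. -/
abbrev ap : List Dir := [.down, .up]

/-- The vertical anti-parallel lock: the strand that enters at the top left passes through a local
minimum and leaves at the top right, the strand that enters at the bottom right passes through a
local maximum and leaves at the bottom left, and the two strands are clasped by two positive
crossings side by side. -/
def lock : Tangle ap ap :=
  Tangle.comp (t := [.down, .down, .up, .up])
    (Tangle.tensor (.id [.down]) (Tangle.tensor (.cup .down) (.id [.up])))
    (Tangle.comp (t := [.down, .down, .up, .up])
      (Tangle.tensor (.cross .down true) (.cross .up true))
      (Tangle.tensor (.id [.down]) (Tangle.tensor (.cap .down) (.id [.up]))))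

/-- The necklace tangle: `n` vertical locks on top of one another. -/
def necklace : ℕ → Tangle ap ap
  | 0 => .id ap
  | n + 1 => .comp (necklace n) lock

/-- The planar tangle made of a cap at the bottom and a cup at the top. -/
def cupCap : Tangle ap ap := .comp (.cap .down) (.cup .down)

/-- The planar tangle `||` of two vertical strands. -/
def vert : Tangle ap ap := .id ap

/-- The closure that joins the top left end to the bottom left end by an arc on the left, and the
top right end to the bottom right end by an arc on the right. -/
def closedClosure (T : Tangle ap ap) : LinkDiagram :=
  Tangle.comp (t := [.up, .down, .up, .down])
    (Tangle.tensor (.cup .up) (.cup .up))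
    (Tangle.comp (t := [.up, .down, .up, .down])
      (Tangle.tensor (.id [.up]) (Tangle.tensor T (.id [.down])))
      (Tangle.tensor (.cap .up) (.cap .up)))

/-- The closure that joins the two top ends by a cap and the two bottom ends by a cup. -/
def openClosure (T : Tangle ap ap) : LinkDiagram :=
  .comp (.cup .down) (.comp T (.cap .down))

/-- The closed necklace with `n` locks. -/
def closedNecklace (n : ℕ) : LinkDiagram := closedClosure (necklace n)

/-- The open necklace with `n` locks. -/
def openNecklace (n : ℕ) : LinkDiagram := openClosure (necklace n)

/-- The positive Hopf link as the closure of the two-strand braid with two positive crossings. -/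
def hopf : LinkDiagram :=
  Tangle.comp (.cup .up) <|
  Tangle.comp (t := [.up, .up, .down, .down])
    (Tangle.tensor (.id [.up]) (Tangle.tensor (.cup .up) (.id [.down]))) <|
  Tangle.comp (t := [.up, .up, .down, .down])
    (Tangle.tensor (.comp (.cross .up true) (.cross .up true)) (.id [.down, .down])) <|
  Tangle.comp (t := [.up, .down])
    (Tangle.tensor (.id [.up]) (Tangle.tensor (.cap .up) (.id [.down])))
    (.cap .up)

end Necklace

open Necklace

namespace Necklace

/-! ### State sums: the diagrams as explicit sums over colourings. -/

section Evaluation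

variable {K : Type*} [Field K]

/-! Everything rests on one skein-type identity, `lock_eval`: a lock equals the cup-cap tangle plus
`φ` times two vertical strands. Write the `R`-matrix as the flip plus a diagonal operator
(`rMatrix_eq`). In the state sum of the lock, flip times flip gives the cup-cap tangle; the other
three products are diagonal, and their total coefficient is the same for all colours because a
weighted geometric sum telescopes (`br_mul_sum_inv_weight`, `sum_diagCoeff_mul_diagCoeff`).

As the cup-cap tangle squares to `D` times itself, powers of the lock follow by induction
(`necklace_eval`), and closing up costs only quantum traces. The Hopf link is computed separately
from the full twist, and has the same values and writhe as the open necklace with one lock.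

The passage to `ℚ(q)(A)` uses regular values of rational functions (`HasValueAt`): candidates are
evaluated at `A = q ^ N`, and uniqueness holds because these points are infinite in number.

For the differential expansions put `s = {A}`, `x = {q}`. Then `{Aq}{A/q} = s² - x²` and `A⁻²(D + φ)
= (s - (s² - x²)A⁻¹)/x`, so `exists_pow_sub_pow_eq` expands the powers. In the closed case the
second summand cancels exactly the part of the correction not divisible by `s`, which lowers the
power of `{A}` in the denominator by one. -/

theorem Coloring.sum_nil {M : Type*} [AddCommMonoid M] {N : ℕ} (f : Coloring N [] → M) :
    ∑ x, f x = f () :=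
  Fintype.sum_unique (ι := Unit) f

theorem Coloring.sum_cons {M : Type*} [AddCommMonoid M] {N : ℕ} {d : Dir} {s : List Dir}
    (f : Coloring N (d :: s) → M) :
    ∑ x, f x = ∑ i : Fin N, ∑ y : Coloring N s, f (i, y) :=
  Fintype.sum_prod_type (α₁ := Fin N) (α₂ := Coloring N s) f

theorem Coloring.ext_two {N : ℕ} {d e : Dir} {K : Type*}
    {M M' : Matrix (Coloring N [d, e]) (Coloring N [d, e]) K}
    (h : ∀ a b i j : Fin N, M (a, b, ()) (i, j, ()) = M' (a, b, ()) (i, j, ())) : M = M' :=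
  Matrix.ext fun x y => h x.1 x.2.1 y.1 y.2.1

theorem Tangle.eval_comp_two (q : K) {N : ℕ} {s t : List Dir} {d e : Dir}
    (S : Tangle s [d, e]) (T : Tangle [d, e] t) (x : Coloring N s) (y : Coloring N t) :
    (Tangle.comp S T).eval q N x y =
      ∑ i : Fin N, ∑ j : Fin N, S.eval q N x (i, j, ()) * T.eval q N (i, j, ()) y := by
  rw [Tangle.eval, Matrix.mul_apply]
  simp_rw [Coloring.sum_cons, Coloring.sum_nil]

theorem Tangle.eval_comp_four (q : K) {N : ℕ} {s t : List Dir} {d e f g : Dir}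
    (S : Tangle s [d, e, f, g]) (T : Tangle [d, e, f, g] t) (x : Coloring N s) (y : Coloring N t) :
    (Tangle.comp S T).eval q N x y =
      ∑ i : Fin N, ∑ j : Fin N, ∑ k : Fin N, ∑ l : Fin N,
        S.eval q N x (i, j, k, l, ()) * T.eval q N (i, j, k, l, ()) y := by
  rw [Tangle.eval, Matrix.mul_apply]
  simp_rw [Coloring.sum_cons, Coloring.sum_nil]

theorem Tangle.eval_id_one (q : K) {N : ℕ} (d : Dir) (i j : Fin N) :
    (Tangle.id [d]).eval q N (i, ()) (j, ()) = if i = j then 1 else 0 := by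
  split_ifs with h
  · subst h
    exact Matrix.one_apply_eq (n := Coloring N [d]) _
  · exact Matrix.one_apply_ne (n := Coloring N [d]) fun e => h (congrArg Prod.fst e)

theorem Tangle.eval_id_two (q : K) {N : ℕ} (d e : Dir) (i j k l : Fin N) :
    (Tangle.id [d, e]).eval q N (i, j, ()) (k, l, ()) = if i = k ∧ j = l then 1 else 0 := by
  split_ifs with h
  · obtain ⟨rfl, rfl⟩ := h
    exact Matrix.one_apply_eq (n := Coloring N [d, e]) _
  · exact Matrix.one_apply_ne (n := Coloring N [d, e]) fun h' =>
      h ⟨congrArg Prod.fst h', congrArg (fun x => x.2.1) h'⟩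

theorem cupCap_eval_apply (q : K) {N : ℕ} (a b c d : Fin N) :
    cupCap.eval q N (a, b, ()) (c, d, ()) =
      if a = b ∧ c = d then (weight q c)⁻¹ else 0 := by
  refine (Matrix.mul_apply (m := Coloring N []) ..).trans ((Coloring.sum_nil _).trans ?_)
  change (if a = b then (1 : K) else 0) * (if c = d then (weight q c)⁻¹ else 0) = _
  rw [ite_and, ite_mul, one_mul, zero_mul]

theorem lock_eval_apply (q : K) {N : ℕ} (a b c d : Fin N) :
    lock.eval q N (a, b, ()) (c, d, ()) =
      ∑ m : Fin N, ∑ r : Fin N,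
        (weight q m)⁻¹ * (rMatrix q r c m a * rMatrix q m b r d) := by
  have h : lock.eval q N (a, b, ()) (c, d, ()) =
      ∑ i : Fin N, ∑ j : Fin N, ∑ k : Fin N, ∑ l : Fin N,
      ((Tangle.id [.down]).eval q N (a, ()) (i, ()) * ((if j = k then (weight q j)⁻¹ else 0) *
        (Tangle.id [.up]).eval q N (b, ()) (l, ()))) *
      ∑ i' : Fin N, ∑ j' : Fin N, ∑ k' : Fin N, ∑ l' : Fin N,
      (rMatrix q j' i' j i * rMatrix q k l k' l') *
      ((Tangle.id [.down]).eval q N (i', ()) (c, ()) * ((if j' = k' then (1 : K) else 0) *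
        (Tangle.id [.up]).eval q N (l', ()) (d, ()))) := by
    refine (Tangle.eval_comp_four ..).trans ?_
    refine Finset.sum_congr rfl fun i _ => Finset.sum_congr rfl fun j _ =>
      Finset.sum_congr rfl fun k _ => Finset.sum_congr rfl fun l _ => congrArg _ ?_
    exact Tangle.eval_comp_four ..
  rw [h]
  simp only [Tangle.eval_id_one]
  simp [Finset.mul_sum]

theorem closedClosure_eval (q : K) (N : ℕ) (T : Tangle ap ap) :
    linkEval q N (closedClosure T) =
      ∑ i : Fin N, ∑ j : Fin N, T.eval q N (i, j, ()) (i, j, ()) * (weight q i * weight q j) := by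
  have h : linkEval q N (closedClosure T) =
      ∑ i : Fin N, ∑ j : Fin N, ∑ k : Fin N, ∑ l : Fin N,
      ((if i = j then (1 : K) else 0) * (if k = l then (1 : K) else 0)) *
      ∑ i' : Fin N, ∑ j' : Fin N, ∑ k' : Fin N, ∑ l' : Fin N,
      ((Tangle.id [.up]).eval q N (i, ()) (i', ()) * (T.eval q N (j, k, ()) (j', k', ()) *
        (Tangle.id [.down]).eval q N (l, ()) (l', ()))) *
      ((if i' = j' then weight q i' else 0) * (if k' = l' then weight q k' else 0)) := by
    refine (Tangle.eval_comp_four ..).trans ?_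
    refine Finset.sum_congr rfl fun i _ => Finset.sum_congr rfl fun j _ =>
      Finset.sum_congr rfl fun k _ => Finset.sum_congr rfl fun l _ => congrArg _ ?_
    exact Tangle.eval_comp_four ..
  rw [h]
  simp only [Tangle.eval_id_one]
  simp

theorem openClosure_eval (q : K) (N : ℕ) (T : Tangle ap ap) :
    linkEval q N (openClosure T) =
      ∑ i : Fin N, ∑ j : Fin N, (weight q i)⁻¹ * T.eval q N (i, i, ()) (j, j, ()) := by
  have h : linkEval q N (openClosure T) =
      ∑ i : Fin N, ∑ j : Fin N, (if i = j then (weight q i)⁻¹ else 0) *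
      ∑ i' : Fin N, ∑ j' : Fin N, T.eval q N (i, j, ()) (i', j', ()) *
        (if i' = j' then (1 : K) else 0) := by
    refine (Tangle.eval_comp_two ..).trans ?_
    refine Finset.sum_congr rfl fun i _ => Finset.sum_congr rfl fun j _ => congrArg _ ?_
    exact Tangle.eval_comp_two ..
  rw [h]
  simp [Finset.mul_sum]

theorem hopf_eval_eq_sum (q : K) (N : ℕ) :
    linkEval q N hopf =
      ∑ i : Fin N, ∑ j : Fin N, (∑ k : Fin N, ∑ l : Fin N, rMatrix q i j k l * rMatrix q k l i j)
        * (weight q i * weight q j) := by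
  -- The full twist is kept opaque as `P`, so that only the Kronecker deltas of the arcs are
  -- contracted.
  obtain ⟨P, hP⟩ : ∃ P : Fin N → Fin N → Fin N → Fin N → K, ∀ i j i' j', P i j i' j' =
      ∑ x : Fin N, ∑ y : Fin N, rMatrix q i j x y * rMatrix q x y i' j' := ⟨_, fun _ _ _ _ => rfl⟩
  suffices linkEval q N hopf = ∑ i : Fin N, ∑ j : Fin N, P i j i j * (weight q i * weight q j) by
    simpa only [hP] using this
  have id₁ (d : Dir) (i j : Fin N) := Tangle.eval_id_one q d i j
  have id₂ (i j k l : Fin N) := Tangle.eval_id_two q .down .down i j k l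
  have h : linkEval q N hopf =
      ∑ a : Fin N, ∑ b : Fin N, (if a = b then (1 : K) else 0) *
      ∑ i : Fin N, ∑ j : Fin N, ∑ k : Fin N, ∑ l : Fin N,
      ((if a = i then (1 : K) else 0) * ((if j = k then (1 : K) else 0) *
        (if b = l then (1 : K) else 0))) *
      ∑ i' : Fin N, ∑ j' : Fin N, ∑ k' : Fin N, ∑ l' : Fin N,
      (P i j i' j' * (if k = k' ∧ l = l' then (1 : K) else 0)) *
      ∑ a' : Fin N, ∑ b' : Fin N,
      ((if i' = a' then (1 : K) else 0) * ((if j' = k' then weight q j' else 0) *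
        (if l' = b' then (1 : K) else 0))) *
      (if a' = b' then weight q a' else 0) := by
    refine (Tangle.eval_comp_two ..).trans ?_
    refine Finset.sum_congr rfl fun a _ => Finset.sum_congr rfl fun b _ => congrArg _ ?_
    refine (Tangle.eval_comp_four ..).trans ?_
    refine Finset.sum_congr rfl fun i _ => Finset.sum_congr rfl fun j _ =>
      Finset.sum_congr rfl fun k _ => Finset.sum_congr rfl fun l _ => ?_
    rw [← id₁ .up, ← id₁ .down b]
    refine congrArg _ ?_
    refine (Tangle.eval_comp_four ..).trans ?_
    refine Finset.sum_congr rfl fun i' _ => Finset.sum_congr rfl fun j' _ =>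
      Finset.sum_congr rfl fun k' _ => Finset.sum_congr rfl fun l' _ => ?_
    have hR : (Tangle.comp (.cross .up true) (.cross .up true)).eval q N (i, j, ()) (i', j', ()) =
      P i j i' j' := (Tangle.eval_comp_two ..).trans (hP ..).symm
    rw [← id₂, ← hR]
    refine congrArg _ ?_
    refine (Tangle.eval_comp_two ..).trans ?_
    refine Finset.sum_congr rfl fun a' _ => Finset.sum_congr rfl fun b' _ => ?_
    rw [← id₁ .up, ← id₁ .down l']
    rfl
  rw [h]
  have h₁ (i' j' k' l' : Fin N) : (∑ a' : Fin N, ∑ b' : Fin N,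
      ((if i' = a' then (1 : K) else 0) * ((if j' = k' then weight q j' else 0) *
        (if l' = b' then (1 : K) else 0))) * (if a' = b' then weight q a' else 0)) =
      if l' = i' then if k' = j' then weight q i' * weight q j' else 0 else 0 := by
    simp [eq_comm, mul_comm]
  have h₂ (i j k l : Fin N) : (∑ i' : Fin N, ∑ j' : Fin N, ∑ k' : Fin N, ∑ l' : Fin N,
      P i j i' j' * (if k = k' ∧ l = l' then (1 : K) else 0) *
        if l' = i' then if k' = j' then weight q i' * weight q j' else 0 else 0) =
      P i j l k * (weight q l * weight q k) := by
    simp [ite_and]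
  simp only [h₁, h₂]
  simp

/-! ### Sums of the quantum trace weights. -/

/-- Telescoping: `{q}` times the inverse weight of index `n` is `q^(N-2n) - q^(N-2n-2)`, and the
extra term `q^(N-2i)` is what the partial sum leaves over. The independence of `i` makes partial
traces scalar. -/
theorem br_mul_sum_inv_weight {q : K} (hq : q ≠ 0) {N : ℕ} (i : Fin N) :
    br q * ∑ m : Fin N, (if m < i then (weight q m)⁻¹ else 0) + q * (weight q i)⁻¹ = q ^ N := by
  have key (n : ℕ) (hn : n ≤ N) : br q * ∑ m : Fin N, (if (m : ℕ) < n then (weight q m)⁻¹ else 0)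
      = q ^ (N : ℤ) - q ^ ((N : ℤ) - 2 * n) := by
    induction n with
    | zero => simp
    | succ n ih =>
      have h (m : Fin N) : (if (m : ℕ) < n + 1 then (weight q m)⁻¹ else 0) =
          (if (m : ℕ) < n then (weight q m)⁻¹ else 0) +
            if (⟨n, hn⟩ : Fin N) = m then (weight q m)⁻¹ else 0 := by
        rcases lt_trichotomy (m : ℕ) n with h | h | h
        · simp [h, h.trans (Nat.lt_succ_self n), Fin.ext_iff, h.ne']
        · simp [h, Fin.ext_iff]
        · simp [h.not_gt, Fin.ext_iff, h.ne, not_lt.2 (Nat.succ_le_of_lt h)]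
      rw [Finset.sum_congr rfl fun m _ => h m, Finset.sum_add_distrib, mul_add,
        ih (Nat.le_of_succ_le hn), Finset.sum_ite_eq, if_pos (Finset.mem_univ _), weight, br,
        ← zpow_neg, sub_mul, ← zpow_neg_one, ← zpow_one_add₀ hq, ← zpow_add₀ hq]
      push_cast
      ring_nf
  have h := key i i.2.le
  simp only [Fin.val_fin_lt] at h
  rw [h, weight, ← zpow_neg, ← zpow_one_add₀ hq, ← zpow_natCast]
  ring_nf

theorem inv_weight_rev (q : K) {N : ℕ} (m : Fin N) : (weight q m.rev)⁻¹ = weight q m := by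
  rw [weight, weight, ← zpow_neg, Fin.val_rev, Nat.cast_sub m.2]
  push_cast
  ring_nf

/-- Mirror image of `br_mul_sum_inv_weight`: reversing `Fin N` inverts the weights. -/
theorem br_mul_sum_weight {q : K} (hq : q ≠ 0) {N : ℕ} (i : Fin N) :
    br q * ∑ m : Fin N, (if i < m then weight q m else 0) + q * weight q i = q ^ N := by
  have h := br_mul_sum_inv_weight hq i.rev
  rw [← Equiv.sum_comp Fin.revPerm] at h
  simpa [inv_weight_rev] using h

theorem br_mul_sum_weight_univ {q : K} (hq : q ≠ 0) (N : ℕ) :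
    br q * ∑ m : Fin N, weight q m = br (q ^ N) := by
  cases N with
  | zero => simp [br]
  | succ N =>
    have h := br_mul_sum_weight hq (0 : Fin (N + 1))
    have hs (m : Fin (N + 1)) : weight q m =
        (if 0 < m then weight q m else 0) + if 0 = m then weight q m else 0 := by
      rcases (Fin.zero_le m).eq_or_lt with h | h
      · simp [← h]
      · simp [h, h.ne]
    rw [Finset.sum_congr rfl fun m _ => hs m, Finset.sum_add_distrib, mul_add,
      eq_sub_of_add_eq h, Finset.sum_ite_eq, if_pos (Finset.mem_univ _)]
    have h₁ : q * weight q (0 : Fin (N + 1)) = q ^ (1 - N : ℤ) := by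
      rw [weight, ← zpow_one_add₀ hq]
      simp [sub_eq_add_neg]
    have h₂ : q⁻¹ * weight q (0 : Fin (N + 1)) = (q ^ (N + 1))⁻¹ := by
      rw [weight, ← zpow_natCast, ← zpow_neg, ← zpow_neg_one, ← zpow_add₀ hq]
      simp
    rw [br, br, sub_mul, h₂]
    ring

theorem sum_inv_weight (q : K) (N : ℕ) :
    ∑ m : Fin N, (weight q m)⁻¹ = ∑ m : Fin N, weight q m := by
  rw [← Equiv.sum_comp Fin.revPerm]
  exact Finset.sum_congr rfl fun m _ => inv_weight_rev q m

theorem sum_weight {q : K} (hq : q ≠ 0) (hb : br q ≠ 0) (N : ℕ) :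
    ∑ m : Fin N, weight q m = dim q (q ^ N) := by
  rw [dim, eq_div_iff hb, mul_comm, br_mul_sum_weight_univ hq]

/-! ### The skein relation of the lock. -/

/-- The coefficient of the diagonal part of `R` when the flip of the two factors is split off. -/
def diagCoeff (q : K) {N : ℕ} (i j : Fin N) : K :=
  if i = j then q - 1 else if i < j then br q else 0

theorem rMatrix_eq (q : K) {N : ℕ} (i j k l : Fin N) :
    rMatrix q i j k l =
      (if k = j then if l = i then 1 else 0 else 0) +
        if k = i then if l = j then diagCoeff q i j else 0 else 0 := by
  unfold rMatrix diagCoeff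
  split_ifs <;> simp_all

/-- This is the scalar by which the lock contributes to two vertical strands coloured `a`, `b`. Only
`m ≤ min a b` survives in the sum; the two flip-diagonal terms complete the summand at the minimum
so that `br_mul_sum_inv_weight` applies. -/
theorem sum_diagCoeff_mul_diagCoeff {q : K} (hq : q ≠ 0) {N : ℕ} (a b : Fin N) :
    ∑ m : Fin N, (weight q m)⁻¹ * (diagCoeff q m a * diagCoeff q m b) +
      ((weight q a)⁻¹ * diagCoeff q a b + (weight q b)⁻¹ * diagCoeff q b a) =
        phi q (q ^ N) := by
  have hb : q * br q = q ^ 2 - 1 := by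
    rw [br]
    field_simp
  -- The expression is symmetric in `a` and `b`, so this also settles `b < a`.
  have of_lt (a b : Fin N) (h : a < b) :
      ∑ m : Fin N, (weight q m)⁻¹ * (diagCoeff q m a * diagCoeff q m b) +
        ((weight q a)⁻¹ * diagCoeff q a b + (weight q b)⁻¹ * diagCoeff q b a) =
          phi q (q ^ N) := by
    have hs (m : Fin N) : (weight q m)⁻¹ * (diagCoeff q m a * diagCoeff q m b) =
        br q ^ 2 * (if m < a then (weight q m)⁻¹ else 0) +
          if a = m then (weight q m)⁻¹ * ((q - 1) * br q) else 0 := by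
      rcases lt_trichotomy m a with h' | h' | h'
      · simp [diagCoeff, h', h'.ne, h'.ne', h'.trans h, (h'.trans h).ne]
        ring
      · subst h'
        simp [diagCoeff, h, h.ne]
      · simp [diagCoeff, h'.not_gt, h'.ne, h'.ne']
    rw [Finset.sum_congr rfl fun m _ => hs m, Finset.sum_add_distrib, ← Finset.mul_sum,
      Finset.sum_ite_eq, if_pos (Finset.mem_univ _), diagCoeff, diagCoeff, if_neg h.ne,
      if_pos h, if_neg h.ne', if_neg h.not_gt, phi, ← br_mul_sum_inv_weight hq a]
    ring
  rcases lt_trichotomy a b with h | rfl | h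
  · exact of_lt a b h
  · have hs (m : Fin N) : (weight q m)⁻¹ * (diagCoeff q m a * diagCoeff q m a) =
        br q ^ 2 * (if m < a then (weight q m)⁻¹ else 0) +
          if a = m then (weight q m)⁻¹ * (q - 1) ^ 2 else 0 := by
      rcases lt_trichotomy m a with h' | h' | h'
      · simp [diagCoeff, h', h'.ne, h'.ne']
        ring
      · subst h'
        simp [diagCoeff, sq]
      · simp [diagCoeff, h'.not_gt, h'.ne, h'.ne']
    rw [Finset.sum_congr rfl fun m _ => hs m, Finset.sum_add_distrib, ← Finset.mul_sum,
      Finset.sum_ite_eq, if_pos (Finset.mem_univ _), diagCoeff, if_pos rfl, phi,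
      ← br_mul_sum_inv_weight hq a]
    linear_combination (-(weight q a)⁻¹) * hb
  · rw [← of_lt b a h, add_comm ((weight q b)⁻¹ * _)]
    simp only [mul_comm (diagCoeff q _ b)]

theorem lock_eval {q : K} (hq : q ≠ 0) (N : ℕ) :
    lock.eval q N = cupCap.eval q N + phi q (q ^ N) • vert.eval q N := by
  refine Coloring.ext_two fun a b c d => (lock_eval_apply q a b c d).trans ?_
  refine Eq.trans ?_ (congrArg₂ (· + phi q (q ^ N) * ·) (cupCap_eval_apply q a b c d)
    (Tangle.eval_id_two q .down .up a b c d)).symm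
  rw [← sum_diagCoeff_mul_diagCoeff hq a b]
  -- The four products in order: flip-flip, the two mixed ones, diagonal-diagonal.
  have h₁ : ∑ m : Fin N, ∑ r : Fin N, (weight q m)⁻¹ *
      ((if m = c then if a = r then 1 else 0 else 0) *
        (if r = b then if d = m then 1 else 0 else 0)) =
      if a = b ∧ c = d then (weight q c)⁻¹ else 0 := by
    by_cases hab : a = b <;> by_cases hcd : c = d <;> simp [hab, hcd, eq_comm]
  have h₂ : ∑ m : Fin N, ∑ r : Fin N, (weight q m)⁻¹ *
      ((if m = c then if a = r then 1 else 0 else 0) *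
        (if r = m then if d = b then diagCoeff q m b else 0 else 0)) =
      (if a = c ∧ b = d then 1 else 0) * ((weight q a)⁻¹ * diagCoeff q a b) := by
    by_cases hac : a = c <;> by_cases hbd : b = d <;> simp [hac, hbd, eq_comm]
  have h₃ : ∑ m : Fin N, ∑ r : Fin N, (weight q m)⁻¹ *
      ((if m = r then if a = c then diagCoeff q r c else 0 else 0) *
        (if r = b then if d = m then 1 else 0 else 0)) =
      (if a = c ∧ b = d then 1 else 0) * ((weight q b)⁻¹ * diagCoeff q b a) := by
    by_cases hac : a = c <;> by_cases hbd : b = d <;> simp [hac, hbd, eq_comm]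
  have h₄ : ∑ m : Fin N, ∑ r : Fin N, (weight q m)⁻¹ *
      ((if m = r then if a = c then diagCoeff q r c else 0 else 0) *
        (if r = m then if d = b then diagCoeff q m b else 0 else 0)) =
      (if a = c ∧ b = d then 1 else 0) *
        ∑ m : Fin N, (weight q m)⁻¹ * (diagCoeff q m a * diagCoeff q m b) := by
    by_cases hac : a = c <;> by_cases hbd : b = d <;> simp [hac, hbd, eq_comm]
  simp only [rMatrix_eq, mul_add, add_mul, Finset.sum_add_distrib, h₁, h₂, h₃, h₄]
  ring

/-! ### Powers of the lock and their closures. -/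

theorem phiTilde_eq_sum {q A : K} (n : ℕ) :
    phiTilde q A n =
      1 / dim q A * ∑ k ∈ Finset.Icc 1 n, (n.choose k : K) * dim q A ^ k * phi q A ^ (n - k) := by
  rw [phiTilde, add_pow, Finset.range_eq_Ico, Finset.sum_eq_sum_Ico_succ_bot (Nat.succ_pos n),
    one_div_mul_eq_div]
  congr 1
  simp only [pow_zero, one_mul, tsub_zero, Nat.choose_zero_right, Nat.cast_one, mul_one,
    add_sub_cancel_left]
  exact Finset.sum_congr rfl fun k _ => by ring

/-- The recursion for the cup-cap coefficient when one more lock is stacked. -/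
theorem phiTilde_succ {q A : K} (hD : dim q A ≠ 0) (n : ℕ) :
    phiTilde q A (n + 1) = phiTilde q A n * (dim q A + phi q A) + phi q A ^ n := by
  unfold phiTilde
  field_simp
  ring

theorem phiTilde_mul_dim {q A : K} (hD : dim q A ≠ 0) (n : ℕ) :
    phiTilde q A n * dim q A = (dim q A + phi q A) ^ n - phi q A ^ n :=
  div_mul_cancel₀ _ hD

/-- Stacking two copies creates one closed circle. -/
theorem cupCap_eval_mul_self {q : K} (hq : q ≠ 0) (hb : br q ≠ 0) (N : ℕ) :
    cupCap.eval q N * cupCap.eval q N = dim q (q ^ N) • cupCap.eval q N := by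
  refine Coloring.ext_two fun a b c d => (Tangle.eval_comp_two q cupCap cupCap _ _).trans ?_
  refine Eq.trans ?_ (congrArg (dim q (q ^ N) * ·) (cupCap_eval_apply q a b c d)).symm
  simp only [cupCap_eval_apply]
  rw [← sum_weight hq hb, ← sum_inv_weight]
  by_cases hab : a = b <;> by_cases hcd : c = d <;> simp [hab, hcd, Finset.sum_mul]

theorem necklace_eval {q : K} (hq : q ≠ 0) (hb : br q ≠ 0) {N : ℕ} (hD : dim q (q ^ N) ≠ 0)
    (n : ℕ) :
    (necklace n).eval q N =
      phiTilde q (q ^ N) n • cupCap.eval q N + phi q (q ^ N) ^ n • vert.eval q N := by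
  have hv : vert.eval q N = 1 := rfl
  induction n with
  | zero => simp [phiTilde, necklace, Tangle.eval, vert]
  | succ n ih =>
    rw [necklace, Tangle.eval, ih, lock_eval hq, hv, phiTilde_succ hD]
    simp only [add_mul, mul_add, smul_mul_assoc, Matrix.mul_smul, cupCap_eval_mul_self hq hb,
      mul_one, one_mul]
    module

theorem closedNecklace_eval {q : K} (hq : q ≠ 0) (hb : br q ≠ 0) {N : ℕ}
    (hD : dim q (q ^ N) ≠ 0) (n : ℕ) :
    linkEval q N (closedNecklace n) =
      phiTilde q (q ^ N) n * dim q (q ^ N) + phi q (q ^ N) ^ n * dim q (q ^ N) ^ 2 := by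
  have hw (i : Fin N) : weight q i ≠ 0 := zpow_ne_zero _ hq
  have he (i j : Fin N) : (necklace n).eval q N (i, j, ()) (i, j, ()) =
      phiTilde q (q ^ N) n * (if i = j ∧ i = j then (weight q i)⁻¹ else 0) +
        phi q (q ^ N) ^ n * (if i = i ∧ j = j then 1 else 0) := by
    rw [necklace_eval hq hb hD]
    exact congrArg₂ (phiTilde q (q ^ N) n * · + phi q (q ^ N) ^ n * ·)
      (cupCap_eval_apply q i j i j) (Tangle.eval_id_two q .down .up i j i j)
  rw [closedNecklace, closedClosure_eval]
  simp only [he]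
  rw [← sum_weight hq hb, sq, Finset.sum_mul_sum]
  simp [add_mul, Finset.sum_add_distrib, Finset.mul_sum, mul_assoc, hw]

theorem openNecklace_eval {q : K} (hq : q ≠ 0) (hb : br q ≠ 0) {N : ℕ}
    (hD : dim q (q ^ N) ≠ 0) (n : ℕ) :
    linkEval q N (openNecklace n) =
      phiTilde q (q ^ N) n * dim q (q ^ N) ^ 2 + phi q (q ^ N) ^ n * dim q (q ^ N) := by
  have he (i j : Fin N) : (necklace n).eval q N (i, i, ()) (j, j, ()) =
      phiTilde q (q ^ N) n * (if i = i ∧ j = j then (weight q j)⁻¹ else 0) +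
        phi q (q ^ N) ^ n * (if i = j ∧ i = j then 1 else 0) := by
    rw [necklace_eval hq hb hD]
    exact congrArg₂ (phiTilde q (q ^ N) n * · + phi q (q ^ N) ^ n * ·)
      (cupCap_eval_apply q i i j j) (Tangle.eval_id_two q .down .up i i j j)
  rw [openNecklace, openClosure_eval]
  simp only [he]
  rw [← sum_weight hq hb, ← sum_inv_weight, sq, Finset.sum_mul_sum]
  simp [mul_add, Finset.sum_add_distrib, Finset.mul_sum, mul_left_comm, mul_comm]

/-! ### The Hopf link. -/

/-- Diagonal entries of the Hecke relation `R² = 1 + {q} R`. -/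
theorem sum_rMatrix_mul_rMatrix {q : K} (hq : q ≠ 0) {N : ℕ} (i j : Fin N) :
    ∑ k : Fin N, ∑ l : Fin N, rMatrix q i j k l * rMatrix q k l i j =
      1 + br q * ((if i = j then q else 0) + br q * (if i < j then 1 else 0)) := by
  have hb : q * br q = q ^ 2 - 1 := by
    rw [br]
    field_simp
  have h : ∑ k : Fin N, ∑ l : Fin N, rMatrix q i j k l * rMatrix q k l i j =
      1 + 2 * (if i = j then diagCoeff q i j else 0) + diagCoeff q i j ^ 2 := by
    simp only [rMatrix_eq, mul_add, add_mul, Finset.sum_add_distrib]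
    by_cases hij : i = j
    · simp [hij]
      ring
    · simp [hij, Ne.symm hij, sq]
  rw [h, diagCoeff]
  rcases lt_trichotomy i j with h | h | h
  · simp [h, h.ne, sq]
  · subst h
    simp
    linear_combination -hb
  · simp [h.ne', h.not_gt]

theorem hopf_eval {q : K} (hq : q ≠ 0) (hb : br q ≠ 0) (N : ℕ) :
    linkEval q N hopf = dim q (q ^ N) * (dim q (q ^ N) + phi q (q ^ N)) := by
  -- The partial trace of the full twist over the second strand is the scalar `D + φ`.
  have h (i : Fin N) : ∑ j : Fin N,
      (1 + br q * ((if i = j then q else 0) + br q * (if i < j then 1 else 0))) *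
        (weight q i * weight q j) = weight q i * (dim q (q ^ N) + phi q (q ^ N)) := by
    rw [← sum_weight hq hb, phi, ← br_mul_sum_weight hq i]
    simp only [add_mul, mul_add, Finset.sum_add_distrib, Finset.mul_sum]
    simp [mul_comm, mul_left_comm, mul_assoc, add_comm, Finset.mul_sum]
  rw [hopf_eval_eq_sum]
  simp only [sum_rMatrix_mul_rMatrix hq, h]
  rw [← Finset.sum_mul, sum_weight hq hb]

end Evaluation

/-! ### Regular values of rational functions. -/

section Value

open Polynomial

variable {k : Type*} [Field k]

/-- The rational function `H` is regular at `a`, with value `v`. -/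
def HasValueAt (H : RatFunc k) (a v : k) : Prop :=
  H.denom.eval a ≠ 0 ∧ H.eval (RingHom.id k) a = v

namespace HasValueAt

variable {H G : RatFunc k} {a v w : k}

theorem const (c : k) : HasValueAt (RatFunc.C c) a c := by
  simp [HasValueAt]

theorem var : HasValueAt RatFunc.X a a := by
  simp [HasValueAt]

theorem add (h : HasValueAt H a v) (g : HasValueAt G a w) : HasValueAt (H + G) a (v + w) := by
  refine ⟨fun e => ?_, ?_⟩
  · have := eval_eq_zero_of_dvd_of_eval_eq_zero (RatFunc.denom_add_dvd H G) e
    rw [eval_mul] at this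
    exact mul_ne_zero h.1 g.1 this
  · rw [RatFunc.eval_add (f := RingHom.id k) (a := a) (by simpa using h.1) (by simpa using g.1), h.2, g.2]

theorem mul (h : HasValueAt H a v) (g : HasValueAt G a w) : HasValueAt (H * G) a (v * w) := by
  refine ⟨fun e => ?_, ?_⟩
  · have := eval_eq_zero_of_dvd_of_eval_eq_zero (RatFunc.denom_mul_dvd H G) e
    rw [eval_mul] at this
    exact mul_ne_zero h.1 g.1 this
  · rw [RatFunc.eval_mul (f := RingHom.id k) (a := a) (by simpa using h.1) (by simpa using g.1), h.2, g.2]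

theorem sub (h : HasValueAt H a v) (g : HasValueAt G a w) : HasValueAt (H - G) a (v - w) := by
  have := h.add ((const (-1)).mul g)
  rwa [map_neg, map_one, neg_one_mul, neg_one_mul, ← sub_eq_add_neg, ← sub_eq_add_neg] at this

theorem pow (h : HasValueAt H a v) (n : ℕ) : HasValueAt (H ^ n) a (v ^ n) := by
  induction n with
  | zero => simpa using const (a := a) (1 : k)
  | succ n ih => simpa only [pow_succ] using ih.mul h

theorem inv (h : HasValueAt H a v) (hv : v ≠ 0) : HasValueAt H⁻¹ a v⁻¹ := by
  have hn : H.num.eval a ≠ 0 := by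
    rintro e
    apply hv
    rw [← h.2, RatFunc.eval, eval₂_id, e, zero_div]
  have hd : H⁻¹.denom.eval a ≠ 0 := by
    intro e
    -- The denominator of `H⁻¹` divides the numerator of `H`.
    refine hn (eval_eq_zero_of_dvd_of_eval_eq_zero ?_ e)
    have := RatFunc.denom_div_dvd H.denom H.num
    rwa [← inv_div, RatFunc.num_div_denom] at this
  have hH : H ≠ 0 := by
    rintro rfl
    simp at hn
  refine ⟨hd, eq_inv_of_mul_eq_one_right ?_⟩
  rw [← h.2, ← RatFunc.eval_mul (f := RingHom.id k) (a := a) (by simpa using h.1) (by simpa using hd), mul_inv_cancel₀ hH,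
    RatFunc.eval_one]

theorem div (h : HasValueAt H a v) (g : HasValueAt G a w) (hw : w ≠ 0) :
    HasValueAt (H / G) a (v / w) := by
  simpa only [div_eq_mul_inv] using h.mul (g.inv hw)

theorem br (h : HasValueAt H a v) (hv : v ≠ 0) : HasValueAt (br H) a (br v) :=
  h.sub (h.inv hv)

end HasValueAt

/-- After cross-multiplication, two polynomials agree at infinitely many points. -/
theorem eq_of_hasValueAt {H G : RatFunc k} {s : Set k} (hs : s.Infinite)
    (h : ∀ a ∈ s, ∃ v, HasValueAt H a v ∧ HasValueAt G a v) : H = G := by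
  rw [← RatFunc.num_div_denom H, ← RatFunc.num_div_denom G,
    div_eq_div_iff (RatFunc.algebraMap_ne_zero H.denom_ne_zero)
      (RatFunc.algebraMap_ne_zero G.denom_ne_zero), ← map_mul, ← map_mul]
  congr 1
  refine eq_of_infinite_eval_eq _ _ (hs.mono fun a ha => ?_)
  obtain ⟨v, ⟨h₁, h₂⟩, g₁, g₂⟩ := h a ha
  rw [RatFunc.eval, eval₂_id, eval₂_id, div_eq_iff h₁] at h₂
  rw [RatFunc.eval, eval₂_id, eval₂_id, div_eq_iff g₁] at g₂
  rw [Set.mem_ofPred_eq, eval_mul, eval_mul, h₂, g₂]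
  ring

end Value

/-! ### Specialization at `A = q ^ N`, and uniqueness of the HOMFLY polynomial. -/

theorem q₀_ne_zero : q₀ ≠ 0 := RatFunc.X_ne_zero

theorem q₀_pow_injective : Function.Injective fun n : ℕ => q₀ ^ n := by
  intro m n h
  simp only [q₀, ← RatFunc.algebraMap_X, ← map_pow] at h
  simpa using congrArg Polynomial.natDegree (RatFunc.algebraMap_injective ℚ h)

theorem br_q₀_pow_ne_zero {n : ℕ} (hn : 1 ≤ n) : br (q₀ ^ n) ≠ 0 := by
  have h₀ := pow_ne_zero n q₀_ne_zero
  intro h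
  replace h := mul_eq_one_iff_eq_inv₀ h₀ |>.2 (sub_eq_zero.1 h)
  rw [← pow_add] at h
  have := q₀_pow_injective (a₁ := n + n) (a₂ := 0) (by simpa using h)
  omega

theorem br_q₀_ne_zero : br q₀ ≠ 0 := by
  simpa using br_q₀_pow_ne_zero le_rfl

theorem dim_q₀_ne_zero {N : ℕ} (hN : 1 ≤ N) : dim q₀ (q₀ ^ N) ≠ 0 :=
  div_ne_zero (br_q₀_pow_ne_zero hN) br_q₀_ne_zero

theorem aa_ne_zero : aa ≠ 0 := RatFunc.X_ne_zero

theorem qq_ne_zero : qq ≠ 0 := (map_ne_zero _).2 q₀_ne_zero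

theorem br_qq_ne_zero : br qq ≠ 0 := by
  have : br qq = RatFunc.C (br q₀) := by simp [br, qq]
  rw [this]
  exact (map_ne_zero _).2 br_q₀_ne_zero

theorem br_aa_ne_zero : br aa ≠ 0 := by
  intro h
  -- The value of `{A}` at `A = q` is `{q}`, which is nonzero.
  have h₁ : HasValueAt (br aa) (q₀ ^ 1) _ := HasValueAt.var.br (pow_ne_zero 1 q₀_ne_zero)
  rw [h] at h₁
  apply br_q₀_pow_ne_zero le_rfl
  rw [← h₁.2, RatFunc.eval_zero]

theorem hasValueAt_dim (N : ℕ) : HasValueAt (dim qq aa) (q₀ ^ N) (dim q₀ (q₀ ^ N)) :=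
  (HasValueAt.var.br (pow_ne_zero N q₀_ne_zero)).div ((HasValueAt.const q₀).br q₀_ne_zero)
    br_q₀_ne_zero

theorem hasValueAt_phi (N : ℕ) : HasValueAt (phi qq aa) (q₀ ^ N) (phi q₀ (q₀ ^ N)) :=
  HasValueAt.var.mul ((HasValueAt.const q₀).br q₀_ne_zero)

theorem IsHomfly.eq {L : LinkDiagram} {H G : KqA} (h : IsHomfly L H) (g : IsHomfly L G) : H = G := by
  refine eq_of_hasValueAt (s := (fun N => q₀ ^ N) '' Set.Ici 1)
    ((Set.Ici_infinite 1).image q₀_pow_injective.injOn) ?_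
  rintro _ ⟨N, hN, rfl⟩
  exact ⟨_, h N hN, g N hN⟩

theorem IsHomfly.iff_eq {L : LinkDiagram} {H G : KqA} (g : IsHomfly L G) :
    IsHomfly L H ↔ H = G :=
  ⟨fun h => h.eq g, fun h => h ▸ g⟩

theorem isHomfly_of_hasValueAt {L : LinkDiagram} {n : ℕ} (hn : L.writhe = n) {G : KqA}
    (h : ∀ N : ℕ, 1 ≤ N → HasValueAt G (q₀ ^ N) (linkEval q₀ N L)) :
    IsHomfly L (aa⁻¹ ^ n * G) := by
  intro N hN
  rw [hn, zpow_neg, zpow_natCast, ← inv_pow]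
  exact ((HasValueAt.var.inv (pow_ne_zero N q₀_ne_zero)).pow n).mul (h N hN)

/-! ### Writhes. -/

theorem writhe_necklace (n : ℕ) : (necklace n).writhe = (2 * n : ℕ) := by
  induction n with
  | zero => rfl
  | succ n ih =>
    rw [necklace, Tangle.writhe, ih]
    simp [lock, Tangle.writhe]
    ring

theorem writhe_closedNecklace (n : ℕ) : (closedNecklace n).writhe = (2 * n : ℕ) := by
  simp [closedNecklace, closedClosure, Tangle.writhe, writhe_necklace]

theorem writhe_openNecklace (n : ℕ) : (openNecklace n).writhe = (2 * n : ℕ) := by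
  have h : (openNecklace n).writhe = 0 + ((necklace n).writhe + 0) := rfl
  rw [h, writhe_necklace, add_zero, zero_add]

theorem writhe_hopf : hopf.writhe = (2 : ℕ) := by
  simp [hopf, Tangle.writhe]

/-! ### Differential expansions. -/

section Laurent

/-- The base is `s` modulo `s² - t` and `ta` modulo `s`. The first congruence gives the factor `s² -
t`, the second identifies the cofactor modulo `s` as `a(ta)^n`. Isolating this residue is what the
closed necklace needs. -/
theorem exists_pow_sub_pow_eq {k : Type*} [Field k] {R : Subring k} {s t a : k} (hs : s ∈ R)
    (ht : t ∈ R) (ha : a ∈ R) (n : ℕ) :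
    ∃ W ∈ R, (s - (s ^ 2 - t) * a) ^ (n + 1) =
      s ^ (n + 1) - (s ^ 2 - t) * (a * ((t * a) ^ n + s * W)) := by
  induction n with
  | zero => exact ⟨0, R.zero_mem, by ring⟩
  | succ n ih =>
    obtain ⟨W, hW, h⟩ := ih
    -- Found by multiplying the residue by the base, written as `ta + s(1 - sa)`.
    refine ⟨s ^ n + (1 - s * a) * (t * a) ^ n + (s - (s ^ 2 - t) * a) * W, ?_, ?_⟩
    · have hu : 1 - s * a ∈ R := R.sub_mem R.one_mem (R.mul_mem hs ha)
      exact R.add_mem (R.add_mem (R.pow_mem hs n) (R.mul_mem hu (R.pow_mem (R.mul_mem ht ha) n)))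
        (R.mul_mem (R.sub_mem hs (R.mul_mem (R.sub_mem (R.pow_mem hs 2) ht) ha)) hW)
    · rw [pow_succ, h]
      ring

/-- The summand with `(s/x)² - 1` equals `(s² - x²) a (x²a)^m / x^(m+1)` and cancels the residue;
the remaining correction carries a factor `s`, hence `s^m` rather than `s^(m+1)` in the denominator.
-/
theorem closed_expansion_identity {k : Type*} [Field k] {s x : k} (hs : s ≠ 0) (hx : x ≠ 0)
    (a W : k) (m : ℕ) :
    (s ^ (m + 1) - (s ^ 2 - x ^ 2) * (a * ((x ^ 2 * a) ^ m + s * W))) / x ^ (m + 1) +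
        (a * x) ^ (m + 1) * ((s / x) ^ 2 - 1) =
      (s / x) ^ (m + 1) * (1 + (s ^ 2 - x ^ 2) / s ^ m * -(a * W)) := by
  rw [div_pow s x 2, div_pow s x]
  field_simp
  ring

theorem open_expansion_identity {k : Type*} [Field k] {s x : k} (hs : s ≠ 0) (hx : x ≠ 0)
    (V : k) (n : ℕ) :
    (s ^ (n + 1) - (s ^ 2 - x ^ 2) * V) / x ^ (n + 1) * (s / x) =
      (s / x) ^ (n + 1 + 1) * (1 + (s ^ 2 - x ^ 2) / s ^ (n + 1) * -V) := by
  rw [div_pow s x]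
  field_simp
  ring

theorem qq_mem : qq ∈ intLaurent := Algebra.subset_adjoin (by simp)
theorem qq_inv_mem : qq⁻¹ ∈ intLaurent := Algebra.subset_adjoin (by simp)
theorem aa_mem : aa ∈ intLaurent := Algebra.subset_adjoin (by simp)
theorem aa_inv_mem : aa⁻¹ ∈ intLaurent := Algebra.subset_adjoin (by simp)

theorem br_mul_br_div {K : Type*} [Field K] {q A : K} (hq : q ≠ 0) (hA : A ≠ 0) :
    br (A * q) * br (A / q) = br A ^ 2 - br q ^ 2 := by
  unfold br
  field_simp
  ring

/-- Follows from `1 - A⁻¹{A} = A⁻²`; it brings the base into the form required by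
`exists_pow_sub_pow_eq`. -/
theorem inv_pow_mul_dim_add_phi {K : Type*} [Field K] {q A : K} (hA : A ≠ 0)
    (hb : br q ≠ 0) :
    A⁻¹ ^ 2 * (dim q A + phi q A) = (br A - (br A ^ 2 - br q ^ 2) * A⁻¹) / br q := by
  have h : A⁻¹ ^ 2 * (br A + A * br q ^ 2) = br A - (br A ^ 2 - br q ^ 2) * A⁻¹ := by
    rw [show br A = A - A⁻¹ from rfl]
    field_simp
    ring
  rw [← h, dim, phi]
  field_simp

theorem exists_closed_expansion (n : ℕ) (hn : 1 ≤ n) : ∃ F ∈ intLaurent,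
    aa⁻¹ ^ (2 * n) * ((dim qq aa + phi qq aa) ^ n + phi qq aa ^ n * (dim qq aa ^ 2 - 1)) =
      dim qq aa ^ n * (1 + br (aa * qq) * br (aa / qq) / br aa ^ (n - 1) * F) := by
  obtain ⟨m, rfl⟩ := Nat.exists_eq_add_of_le' hn
  have hA := aa_ne_zero
  have hx := br_qq_ne_zero
  have hs := br_aa_ne_zero
  obtain ⟨W, hW, h⟩ := exists_pow_sub_pow_eq (R := intLaurent.toSubring) (s := br aa) (t := br qq ^ 2)
    (a := aa⁻¹) (sub_mem aa_mem aa_inv_mem) (pow_mem (sub_mem qq_mem qq_inv_mem) 2) aa_inv_mem m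
  refine ⟨-(aa⁻¹ * W), neg_mem (mul_mem aa_inv_mem hW), ?_⟩
  have hphi : aa⁻¹ ^ 2 * phi qq aa = aa⁻¹ * br qq := by
    rw [phi]
    field_simp
  rw [mul_add, pow_mul, ← mul_pow, ← mul_assoc, ← mul_pow, inv_pow_mul_dim_add_phi hA hx, hphi,
    br_mul_br_div qq_ne_zero hA, div_pow, h, dim, Nat.add_sub_cancel]
  exact closed_expansion_identity hs hx _ _ _

theorem exists_open_expansion (n : ℕ) : ∃ F ∈ intLaurent,
    aa⁻¹ ^ (2 * n) * dim qq aa * (dim qq aa + phi qq aa) ^ n =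
      dim qq aa ^ (n + 1) * (1 + br (aa * qq) * br (aa / qq) / br aa ^ n * F) := by
  cases n with
  -- Without locks the value is `D` itself; the power lemma starts at exponent one.
  | zero => exact ⟨0, zero_mem _, by simp⟩
  | succ n =>
    have hx := br_qq_ne_zero
    have hs := br_aa_ne_zero
    have hs' : br aa ∈ intLaurent := sub_mem aa_mem aa_inv_mem
    have ht : br qq ^ 2 ∈ intLaurent := pow_mem (sub_mem qq_mem qq_inv_mem) 2
    obtain ⟨W, hW, h⟩ := exists_pow_sub_pow_eq (R := intLaurent.toSubring) hs' ht aa_inv_mem n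
    refine ⟨-(aa⁻¹ * ((br qq ^ 2 * aa⁻¹) ^ n + br aa * W)), neg_mem (mul_mem aa_inv_mem
      (add_mem (pow_mem (mul_mem ht aa_inv_mem) n) (mul_mem hs' hW))), ?_⟩
    rw [mul_right_comm, pow_mul, ← mul_pow, inv_pow_mul_dim_add_phi aa_ne_zero hx,
      br_mul_br_div qq_ne_zero aa_ne_zero, div_pow, h, dim]
    exact open_expansion_identity hs hx _ _

end Laurent

/-! ### HOMFLY polynomials of the necklaces and of the Hopf link. -/

theorem isHomfly_closedNecklace (n : ℕ) : IsHomfly (closedNecklace n) (aa⁻¹ ^ (2 * n) *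
    ((dim qq aa + phi qq aa) ^ n + phi qq aa ^ n * (dim qq aa ^ 2 - 1))) := by
  refine isHomfly_of_hasValueAt (writhe_closedNecklace n) fun N hN => ?_
  have hD := dim_q₀_ne_zero hN
  have hd := hasValueAt_dim N
  have hp := hasValueAt_phi N
  have h := ((hd.add hp).pow n).add ((hp.pow n).mul ((hd.pow 2).sub (HasValueAt.const 1)))
  rw [map_one] at h
  convert h using 1
  rw [closedNecklace_eval q₀_ne_zero br_q₀_ne_zero hD, phiTilde_mul_dim hD]
  ring

theorem isHomfly_of_linkEval {L : LinkDiagram} {n : ℕ} (m : ℕ) (hn : L.writhe = n)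
    (h : ∀ N : ℕ, 1 ≤ N → linkEval q₀ N L =
      dim q₀ (q₀ ^ N) * (dim q₀ (q₀ ^ N) + phi q₀ (q₀ ^ N)) ^ m) :
    IsHomfly L (aa⁻¹ ^ n * dim qq aa * (dim qq aa + phi qq aa) ^ m) := by
  rw [mul_assoc]
  refine isHomfly_of_hasValueAt hn fun N hN => ?_
  rw [h N hN]
  exact (hasValueAt_dim N).mul (((hasValueAt_dim N).add (hasValueAt_phi N)).pow m)

theorem isHomfly_openNecklace (n : ℕ) : IsHomfly (openNecklace n)
    (aa⁻¹ ^ (2 * n) * dim qq aa * (dim qq aa + phi qq aa) ^ n) := by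
  refine isHomfly_of_linkEval n (writhe_openNecklace n) fun N hN => ?_
  have hD := dim_q₀_ne_zero hN
  rw [openNecklace_eval q₀_ne_zero br_q₀_ne_zero hD, sq, ← mul_assoc, phiTilde_mul_dim hD]
  ring

theorem isHomfly_hopf : IsHomfly hopf
    (aa⁻¹ ^ (2 * 1) * dim qq aa * (dim qq aa + phi qq aa) ^ 1) := by
  refine isHomfly_of_linkEval 1 writhe_hopf fun N _ => ?_
  rw [hopf_eval q₀_ne_zero br_q₀_ne_zero, pow_one]

theorem hopf_polynomial_eq {K : Type*} [Field K] {q A : K} (hq : q ≠ 0) (hA : A ≠ 0)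
    (hb : br q ≠ 0) :
    A⁻¹ ^ (2 * 1) * dim q A * (dim q A + phi q A) ^ 1 =
      A⁻¹ * (br A / br q ^ 2) * (-(A ^ 2)⁻¹ + q ^ 2 + (q ^ 2)⁻¹ - 1) := by
  rw [mul_one, pow_one, mul_right_comm, inv_pow_mul_dim_add_phi hA hb, dim, div_mul_div_comm,
    ← sq, mul_comm, mul_div_assoc', mul_comm (br A), mul_comm A⁻¹, div_mul_eq_mul_div]
  congr 1
  unfold br
  field_simp
  ring

theorem hopf_polynomial_expansion {K : Type*} [Field K] {q A : K} (hq : q ≠ 0) (hA : A ≠ 0)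
    (hb : br q ≠ 0) (hs : br A ≠ 0) :
    A⁻¹ * (br A / br q ^ 2) * (-(A ^ 2)⁻¹ + q ^ 2 + (q ^ 2)⁻¹ - 1) =
      dim q A ^ 2 * (1 - A⁻¹ * (br (A * q) * br (A / q) / br A)) := by
  rw [← hopf_polynomial_eq hq hA hb, mul_one, pow_one, mul_right_comm,
    inv_pow_mul_dim_add_phi hA hb, br_mul_br_div hq hA, dim]
  field_simp

end Necklace

open Necklace
theorem mainTheorem10 :
    -- the quotient `Φ̃_n` is given by the binomial sum, for generic `A` and for `A = q ^ N`
    (∀ n : ℕ, phiTilde qq aa n =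
      1 / dim qq aa * ∑ k ∈ Finset.Icc 1 n,
        (n.choose k : KqA) * dim qq aa ^ k * phi qq aa ^ (n - k)) ∧
    (∀ N : ℕ, 1 ≤ N → ∀ n : ℕ, dim q₀ (q₀ ^ N) ≠ 0 ∧ phiTilde q₀ (q₀ ^ N) n =
      1 / dim q₀ (q₀ ^ N) * ∑ k ∈ Finset.Icc 1 n,
        (n.choose k : Kq) * dim q₀ (q₀ ^ N) ^ k * phi q₀ (q₀ ^ N) ^ (n - k)) ∧
    -- the planar decomposition of the necklace tangle
    (∀ N : ℕ, 1 ≤ N → ∀ n : ℕ,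
      (necklace n).eval q₀ N =
        phiTilde q₀ (q₀ ^ N) n • cupCap.eval q₀ N + phi q₀ (q₀ ^ N) ^ n • vert.eval q₀ N) ∧
    -- the values of its two closures, in the vertical framing
    (∀ N : ℕ, 1 ≤ N → ∀ n : ℕ,
      linkEval q₀ N (closedNecklace n) =
        phiTilde q₀ (q₀ ^ N) n * dim q₀ (q₀ ^ N)
          + phi q₀ (q₀ ^ N) ^ n * dim q₀ (q₀ ^ N) ^ 2 ∧
      linkEval q₀ N (openNecklace n) =
        phiTilde q₀ (q₀ ^ N) n * dim q₀ (q₀ ^ N) ^ 2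
          + phi q₀ (q₀ ^ N) ^ n * dim q₀ (q₀ ^ N)) ∧
    -- the HOMFLY polynomials of the closed and of the open necklace
    (∀ (n : ℕ) (H : KqA), IsHomfly (closedNecklace n) H ↔
      H = aa⁻¹ ^ (2 * n) *
        ((dim qq aa + phi qq aa) ^ n + phi qq aa ^ n * (dim qq aa ^ 2 - 1))) ∧
    (∀ (n : ℕ) (H : KqA), IsHomfly (openNecklace n) H ↔
      H = aa⁻¹ ^ (2 * n) * dim qq aa * (dim qq aa + phi qq aa) ^ n) ∧
    -- their differential expansions
    (∀ n : ℕ, 1 ≤ n → ∃ F ∈ intLaurent,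
      aa⁻¹ ^ (2 * n) * ((dim qq aa + phi qq aa) ^ n + phi qq aa ^ n * (dim qq aa ^ 2 - 1)) =
        dim qq aa ^ n * (1 + br (aa * qq) * br (aa / qq) / br aa ^ (n - 1) * F)) ∧
    (∀ n : ℕ, ∃ F ∈ intLaurent,
      aa⁻¹ ^ (2 * n) * dim qq aa * (dim qq aa + phi qq aa) ^ n =
        dim qq aa ^ (n + 1) * (1 + br (aa * qq) * br (aa / qq) / br aa ^ n * F)) ∧
    -- the Hopf link is the open necklace with one lock
    (∀ H : KqA, IsHomfly hopf H ↔ IsHomfly (openNecklace 1) H) ∧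
    (∀ H : KqA, IsHomfly hopf H ↔
      H = aa⁻¹ * (br aa / br qq ^ 2) * (-(aa ^ 2)⁻¹ + qq ^ 2 + (qq ^ 2)⁻¹ - 1)) ∧
    (aa⁻¹ * (br aa / br qq ^ 2) * (-(aa ^ 2)⁻¹ + qq ^ 2 + (qq ^ 2)⁻¹ - 1) =
      dim qq aa ^ 2 * (1 - aa⁻¹ * (br (aa * qq) * br (aa / qq) / br aa))) := by
  have hq := q₀_ne_zero
  have hb := br_q₀_ne_zero
  have hD {N : ℕ} (hN : 1 ≤ N) := dim_q₀_ne_zero hN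
  have hexp := hopf_polynomial_expansion qq_ne_zero aa_ne_zero br_qq_ne_zero br_aa_ne_zero
  refine ⟨phiTilde_eq_sum, fun N hN n => ⟨hD hN, phiTilde_eq_sum n⟩,
    fun N hN => necklace_eval hq hb (hD hN),
    fun N hN n => ⟨closedNecklace_eval hq hb (hD hN) n, openNecklace_eval hq hb (hD hN) n⟩,
    fun n H => (isHomfly_closedNecklace n).iff_eq, fun n H => (isHomfly_openNecklace n).iff_eq,
    exists_closed_expansion, exists_open_expansion,
    fun H => isHomfly_hopf.iff_eq.trans (isHomfly_openNecklace 1).iff_eq.symm, fun H => ?_, hexp⟩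
  rw [← hopf_polynomial_eq qq_ne_zero aa_ne_zero br_qq_ne_zero]
  exact isHomfly_hopf.iff_eq
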